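/- **Sequence-form characterization of normal-form perfect equilibria.** Let $\Gamma$ be a finite extensive-form game with perfect recall, with finite player set $N$ and chance player $c$, whose information sets are singletons; put $N_c=N\cup\{c\}$. Write $Z$ for the terminal histories, $u_z^i$ for the payoff of player $i$ at terminal histories, and $f_c(a\mid h)$ for the chance probabilities. Let $\mathcal I_i$ be the collection of information sets of player $i$ and $A(I)$ the actions available at $I\in\mathcal I_i$; actions at different information sets are regarded as distinct. *Sequences.* For a history $h$, $w^i_h$ is the sequence of actions taken by $i\in N_c$ along $h$, and $W^i$ is the set of all these sequences. By perfect recall all $h\in I$ have the same $w^i_h$, denoted $w^i_I$; $w^i_Ia$ is its extension by $a\in A(I)$. *Normal form.* A (reduced) pure strategy $s^i$ of player $i\in N$ assigns an action in $A(I)$ to exactly those $I\in\mathcal I_i$ for which $s^i$ takes all the actions in $w^i_I$. Let $S^i$ be the set of these, $\Xi^i$ the set of probability vectors on $S^i$, and $\Xi=\prod_{i\in N}\Xi^i$. The chance player's pure strategies choose an action after every chance history and have the product probabilities given by $f_c$. Let $u^i(s^i,\sigma^{-i})$ be the expected payoff of $i$ when $i$ plays $s^i$, the other players play according to $\sigma$,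 and chance plays its mixed strategy. For $\varepsilon>0$, a profile $\sigma\in\Xi$ with all $\sigma^i(s^i)>0$ is an $\varepsilon$-normal-form perfect equilibrium if, for all $i\in N$ and $s^i,\tilde s^i\in S^i$, $u^i(s^i,\sigma^{-i})<u^i(\tilde s^i,\sigma^{-i})$ implies $\sigma^i(s^i)\le\varepsilon$. A profile $\sigma^*\in\Xi$ is a normal-form perfect equilibrium if there are $\varepsilon^k>0$ with $\varepsilon^k\to0$ and $\varepsilon^k$-normal-form perfect equilibria $\sigma(\varepsilon^k)$ such that $\sigma^*$ is a limit point of $\{\sigma(\varepsilon^k)\}_k$. *Sequence form.* For $i\in N$, the set $\Lambda^i$ of realization plans consists of the $\gamma^i:W^i\to\mathbb R$ with $\gamma^i(\emptyset)=1$ and, for all $I\in\mathcal I_i$, $\sum_{a\in A(I)}\gamma^i(w^i_Ia)=\gamma^i(w^i_I)$ and $\gamma^i(w^i_Ia)\ge0$ for all $a\in A(I)$. For the chance player, $\gamma^c(w^c)$ is the product of the probabilities of the actions in $w^c$. For $w\in\prod_{j\in N_c}W^j$ let $g^i(w)=u^i_z(h)$ if $w=(w^j_h)_{j\in N_c}$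 for some (necessarily unique) $h\in Z$, and $g^i(w)=0$ otherwise; and let $g^i(w^i,\gamma^{-i})=\sum_{w^{-i}}g^i(w^i,w^{-i})\prod_{j\in N_c\setminus\{i\}}\gamma^j(w^j)$. *Perturbed games.* For $\varepsilon>0$, a perturbation is a vector $\eta(\varepsilon)=(\eta^i(\varepsilon;w^i))_{i\in N,\,w^i\in W^i}$ with $$\sum_{a\in A(I)}\eta^i(\varepsilon;w^i_Ia)=\eta^i(\varepsilon;w^i_I),\qquad 0<\eta^i(\varepsilon;w^i_Ia)\le\varepsilon\qquad(i\in N,\ I\in\mathcal I_i,\ a\in A(I)).$$ In a perturbed game $\Gamma_s(\varepsilon)$, which is given by such an $\eta(\varepsilon)$, the strategy set of player $i\in N$ is $\Lambda^i(\varepsilon)=\{\gamma^i\in\Lambda^i:\gamma^i(w^i)\ge\eta^i(\varepsilon;w^i)\text{ for all }w^i\in W^i\}$. A Nash equilibrium of $\Gamma_s(\varepsilon)$ is a profile $\gamma$ such that, for every $i\in N$, $\gamma^i$ maximizes $\sum_{I\in\mathcal I_i}\sum_{a\in A(I)}x(w^i_Ia)\,g^i(w^i_Ia,\gamma^{-i})$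 over $x\in\Lambda^i(\varepsilon)$. *Theorem.* Let $\sigma^*\in\Xi$ and let $\gamma^*$ be its realization plan profile, that is, $\gamma^{*i}(w^i)=\sum\sigma^{*i}(s^i)$ for $i\in N$ and $w^i\in W^i$, the sum being over those $s^i\in S^i$ that take all the actions in $w^i$. Then $\sigma^*$ is a normal-form perfect equilibrium of $\Gamma$ if and only if there exist a sequence $\varepsilon^k>0$ with $\varepsilon^k\to0$, perturbed games $\Gamma_s(\varepsilon^k)$ (each with some perturbation $\eta(\varepsilon^k)$), and Nash equilibria $\gamma^*(\varepsilon^k)$ of $\Gamma_s(\varepsilon^k)$ such that $\lim_{k\to\infty}\gamma^*(\varepsilon^k)=\gamma^*$. -/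

import Mathlib

section

open scoped Classical

/-- The tree of a finite extensive-form game with players `N`, histories being finite lists of
actions. The chance player is `none : Option N`. The value `P h` only matters for nonterminal
histories `h`. -/
structure GameTree (N A : Type*) where
  /-- the finite set of histories -/
  H : Finset (List A)
  nil_mem : [] ∈ H
  prefix_mem : ∀ (h : List A) (a : A), h ++ [a] ∈ H → h ∈ H
  /-- the player who moves after a nonterminal history -/
  P : List A → Option N

namespace GameTree

variable {N A : Type*} (G : GameTree N A)

/-- The terminal histories. -/
noncomputable def Z : Finset (List A) := G.H.filter fun h => ∀ a, h ++ [a] ∉ G.H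

/-- The nonterminal histories after which player `i` moves. -/
noncomputable def nodes (i : Option N) : Finset (List A) :=
  G.H.filter fun h => (∃ a, h ++ [a] ∈ G.H) ∧ G.P h = i

/-- The actions available after a history: `A(h) = {a : (h, a) ∈ H}`. -/
noncomputable def actions (h : List A) : Finset A :=
  (G.H.biUnion List.toFinset).filter fun a => h ++ [a] ∈ G.H

theorem mem_actions {h : List A} {a : A} : a ∈ G.actions h ↔ h ++ [a] ∈ G.H := by
  unfold actions
  rw [Finset.mem_filter, Finset.mem_biUnion]
  exact ⟨fun x => x.2, fun x => ⟨⟨_, x, by simp⟩, x⟩⟩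

end GameTree

/-- A finite extensive-form game: a game tree with chance probabilities, information partitions
of the players and payoffs at terminal histories. -/
structure ExtensiveGame (N A : Type*) extends GameTree N A where
  /-- `f h a` is the probability that chance takes action `a` after `h` -/
  f : List A → A → ℝ
  f_nonneg : ∀ h ∈ toGameTree.nodes none, ∀ a ∈ toGameTree.actions h, 0 ≤ f h a
  f_sum : ∀ h ∈ toGameTree.nodes none, ∑ a ∈ toGameTree.actions h, f h a = 1
  /-- the information partition of each player -/
  info : (i : N) → Finpartition (toGameTree.nodes (some i))
  actions_eq : ∀ (i : N), ∀ I ∈ (info i).parts, ∀ h ∈ I, ∀ h' ∈ I,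
    toGameTree.actions h = toGameTree.actions h'
  /-- payoff of each player; only the values at terminal histories matter -/
  payoff : N → List A → ℝ

namespace ExtensiveGame

variable {N A : Type*} (G : ExtensiveGame N A)

/-- The information partition of any player; the information sets of chance are singletons. -/
noncomputable def partition : (i : Option N) → Finpartition (G.nodes i)
  | none => ⊥
  | some i => G.info i

/-- The type of information sets of player `i`. -/
abbrev Info (i : Option N) : Type _ := {I : Finset (List A) // I ∈ (G.partition i).parts}

variable {G} in
/-- The actions available at an information set (the sets `A(h)`, `h ∈ I`, all coincide). -/
noncomputable def acts {i : Option N} (I : G.Info i) : Finset A := I.1.biUnion G.actions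

/-- An action of player `i`, tagged by the information set at which it is taken, so that actions
at different information sets are distinct. -/
abbrev Choice (i : Option N) : Type _ := Σ I : G.Info i, {a : A // a ∈ acts I}

/-- The information set of player `i` containing a given decision node of `i`. -/
noncomputable def infoAt (i : Option N) (h : List A) (hh : h ∈ G.nodes i) : G.Info i :=
  ⟨(G.partition i).part h, (G.partition i).part_mem.2 hh⟩

theorem mem_acts_infoAt {i : Option N} {h : List A} {a : A} (hh : h ∈ G.nodes i)
    (ha : h ++ [a] ∈ G.H) : a ∈ acts (G.infoAt i h hh) :=
  Finset.mem_biUnion.2 ⟨h, (G.partition i).mem_part hh, G.mem_actions.2 ha⟩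

/-- The moves along a history `⟨a₁, …, a_L⟩`: the pairs `(⟨a₁, …, a_q⟩, a_{q+1})`, `0 ≤ q < L`. -/
def moves (h : List A) : List (List A × A) := h.inits.zip h

/-- The move `(h, a)` as an action of player `i`, if it is one. -/
noncomputable def choiceAt (i : Option N) (m : List A × A) : Option (G.Choice i) :=
  if hm : m.1 ∈ G.nodes i ∧ m.1 ++ [m.2] ∈ G.H then
    some ⟨G.infoAt i m.1 hm.1, m.2, G.mem_acts_infoAt hm.1 hm.2⟩
  else none

/-- The record of player `i`'s experience along `h`: the information sets of `i` passed through
and the actions taken there, in order. It also serves as the sequence `w^i_h` of `i`. -/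
noncomputable def record (i : Option N) (h : List A) : List (G.Choice i) :=
  (moves h).filterMap (G.choiceAt i)

/-- Perfect recall: histories in one information set of a player give her the same record. -/
def PerfectRecall : Prop :=
  ∀ (i : N), ∀ I ∈ (G.info i).parts, ∀ h ∈ I, ∀ h' ∈ I,
    G.record (some i) h = G.record (some i) h'

/-- The set `W^i` of sequences of player `i`. -/
abbrev Seq (i : Option N) : Type _ :=
  {w : List (G.Choice i) // w ∈ G.H.image (G.record i)}

/-- The empty sequence. -/
noncomputable def emptySeq (i : Option N) : G.Seq i :=
  ⟨[], Finset.mem_image.2 ⟨[], G.nil_mem, rfl⟩⟩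

variable {G}

/-- A history in the information set `I`. -/
noncomputable def Info.rep {i : Option N} (I : G.Info i) : List A :=
  ((G.partition i).nonempty_of_mem_parts I.2).choose

theorem Info.rep_mem {i : Option N} (I : G.Info i) : I.rep ∈ I.1 :=
  ((G.partition i).nonempty_of_mem_parts I.2).choose_spec

theorem Info.rep_mem_nodes {i : Option N} (I : G.Info i) : I.rep ∈ G.nodes i :=
  (G.partition i).le I.2 I.rep_mem

theorem Info.infoAt_rep {i : Option N} (I : G.Info i) :
    G.infoAt i I.rep I.rep_mem_nodes = I :=
  Subtype.ext ((G.partition i).part_eq_of_mem I.2 I.rep_mem)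

theorem Info.rep_append_mem {i : Option N} (I : G.Info i) {a : A} (ha : a ∈ acts I) :
    I.rep ++ [a] ∈ G.H := by
  obtain ⟨h, hI, hah⟩ := Finset.mem_biUnion.1 ha
  rw [← G.mem_actions]
  cases i with
  | none =>
    have h2 : I.1 ∈ (⊥ : Finpartition (G.nodes none)).parts := I.2
    rw [Finpartition.mem_bot_iff] at h2
    obtain ⟨b, -, hb⟩ := h2
    have h3 := I.rep_mem
    rw [← hb, Finset.mem_singleton] at h3 hI
    rw [h3, ← hI]
    exact hah
  | some i => rw [G.actions_eq i I.1 I.2 _ I.rep_mem h hI]; exact hah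

theorem moves_append (h : List A) (a : A) : moves (h ++ [a]) = moves h ++ [(h, a)] := by
  have key : ∀ (b : A) (l : List A),
      moves (b :: l) = ([], b) :: (moves l).map (Prod.map (List.cons b) id) := by
    intro b l
    simp [moves, List.zip_map_left]
  induction h with
  | nil => rfl
  | cons b l ih => simp [key, ih]

theorem record_rep_append {i : Option N} (I : G.Info i) (a : {a : A // a ∈ acts I}) :
    G.record i (I.rep ++ [a.1]) = G.record i I.rep ++ [⟨I, a⟩] := by
  have key : ∀ (J : G.Info i) (hJ : a.1 ∈ acts J), J = I →
      (⟨J, a.1, hJ⟩ : G.Choice i) = ⟨I, a⟩ := by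
    rintro J hJ rfl
    rfl
  have h1 : G.choiceAt i (I.rep, a.1) = some ⟨I, a⟩ := by
    unfold choiceAt
    rw [dif_pos ⟨I.rep_mem_nodes, I.rep_append_mem a.2⟩, key _ _ I.infoAt_rep]
  rw [record, moves_append, List.filterMap_append]
  simp [h1, record]

/-- The sequence `w^i_I` leading to `I` (under perfect recall the same for all `h ∈ I`). -/
noncomputable def seqTo {i : Option N} (I : G.Info i) : G.Seq i :=
  ⟨G.record i I.rep, Finset.mem_image_of_mem _ (Finset.mem_filter.1 I.rep_mem_nodes).1⟩

/-- The extended sequence `w^i_I a`. -/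
noncomputable def ext {i : Option N} (I : G.Info i) (a : {a : A // a ∈ acts I}) : G.Seq i :=
  ⟨(seqTo I).1 ++ [⟨I, a⟩], Finset.mem_image.2
    ⟨I.rep ++ [a.1], I.rep_append_mem a.2, record_rep_append I a⟩⟩

variable (G)

/-! ### The reduced normal form -/

/-- Pure strategies. A (reduced) pure strategy of a player `some i` prescribes an action exactly
at those information sets which her own earlier prescriptions do not exclude. A pure strategy of
chance prescribes an action at every information set of chance. -/
abbrev PureStrategy (i : Option N) : Type _ :=
  {s : (I : G.Info i) → Option {a : A // a ∈ acts I} //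
    ∀ I, (s I).isSome = true ↔ (i = none ∨ ∀ c ∈ (seqTo I).1, s c.1 = some c.2)}

variable {G}

/-- `s^i(a)`: it is `1` if `s^i` takes the action `a` at its information set, otherwise `0`. -/
noncomputable def PureStrategy.val {i : Option N} (s : G.PureStrategy i) (c : G.Choice i) : ℝ :=
  if s.1 c.1 = some c.2 then 1 else 0

/-- `s^i(w^i) = ∏_{a ∈ w^i} s^i(a)`. -/
noncomputable def PureStrategy.seqVal {i : Option N} (s : G.PureStrategy i) (w : G.Seq i) : ℝ :=
  (w.1.map s.val).prod

variable (G)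

/-- The payoff of player `i` under a pure strategy profile (including chance):
`u^i(s) = ∑_{h ∈ Z} u^i_z(h) ∏_q s^{P(⟨a₁, …, a_q⟩)}(a_{q+1})`. -/
noncomputable def purePayoff (i : N) (s : (j : Option N) → G.PureStrategy j) : ℝ :=
  ∑ h ∈ G.Z, G.payoff i h *
    ((moves h).map fun m => (G.choiceAt (G.P m.1) m).elim 0 (s (G.P m.1)).val).prod

/-- The mixed strategy of chance: `σ^c(s^c) = ∏_{P(h) = c} ∑_{a ∈ A(h)} s^c(a) f_c(a | h)`. -/
noncomputable def chanceMixed (s : G.PureStrategy none) : ℝ :=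
  ∏ h ∈ G.nodes none, ∑ a ∈ G.actions h, (G.choiceAt none (h, a)).elim 0 s.val * G.f h a

/-- Families of weights on the pure strategies of the players. -/
abbrev StrategyProfile : Type _ := (i : N) → G.PureStrategy (some i) → ℝ

/-- Families of weights on the sequences of the players. -/
abbrev SeqProfile : Type _ := (i : N) → G.Seq (some i) → ℝ

variable {G}

/-- A strategy profile completed by the mixed strategy of chance. -/
noncomputable def withChance (σ : G.StrategyProfile) : (j : Option N) → G.PureStrategy j → ℝ
  | none => G.chanceMixed
  | some i => σ i

/-- `u^i(s^i, σ^{-i})`: the sum over all profiles of pure strategies whose `i`-th entry is `s^i`,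
weighted by the product of the probabilities of the other entries (including chance). -/
noncomputable def payoffAgainst [Fintype N] (i : N) (s : G.PureStrategy (some i))
    (σ : G.StrategyProfile) : ℝ :=
  ∑ t : ((j : Option N) → G.PureStrategy j) with t (some i) = s,
    G.purePayoff i t * ∏ j ∈ Finset.univ.erase (some i), withChance σ j (t j)

variable (G)

/-- The set `Ξ` of mixed strategy profiles. -/
def mixedProfiles : Set G.StrategyProfile :=
  {σ | ∀ i, σ i ∈ stdSimplex ℝ (G.PureStrategy (some i))}

variable {G}

/-- `ε`-normal-form perfect equilibria: totally mixed profiles in which any pure strategy that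
is not a best response has probability at most `ε`. -/
def IsEpsPerfect [Fintype N] (ε : ℝ) (σ : G.StrategyProfile) : Prop :=
  σ ∈ G.mixedProfiles ∧ (∀ i s, 0 < σ i s) ∧
    ∀ (i : N) (s s' : G.PureStrategy (some i)),
      payoffAgainst i s σ < payoffAgainst i s' σ → σ i s ≤ ε

/-- Normal-form perfect equilibria: limit points of sequences of `ε^k`-normal-form perfect
equilibria with `ε^k → 0`. -/
def IsNormalFormPerfect [Fintype N] (σ : G.StrategyProfile) : Prop :=
  σ ∈ G.mixedProfiles ∧
    ∃ (ε : ℕ → ℝ) (τ : ℕ → G.StrategyProfile), (∀ k, 0 < ε k) ∧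
      Filter.Tendsto ε Filter.atTop (nhds 0) ∧ (∀ k, IsEpsPerfect (ε k) (τ k)) ∧
      MapClusterPt σ Filter.atTop τ

/-! ### The sequence form -/

variable (G)

/-- The payoff `g^i(w)` at a profile of sequences (including chance): it is `u^i_z(h)` if `w` is
defined by the terminal history `h`, and `0` if there is no such `h`. A profile of sequences is
defined by at most one terminal history, so the sum has at most one term. -/
noncomputable def seqPayoff (i : N) (w : (j : Option N) → G.Seq j) : ℝ :=
  ∑ h ∈ G.Z with ∀ j, G.record j h = (w j).1, G.payoff i h

/-- The realization plan of chance: `γ^c(w^c)` is the product of the probabilities of the actions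
in `w^c` (recall that the information sets of chance are singletons `{h}`). -/
noncomputable def chancePlan (w : G.Seq none) : ℝ :=
  (w.1.map fun c => ∏ h ∈ c.1.1, G.f h c.2.1).prod

variable {G}

/-- A profile of realization plans completed by the plan of chance. -/
noncomputable def planWithChance (γ : G.SeqProfile) : (j : Option N) → G.Seq j → ℝ
  | none => G.chancePlan
  | some i => γ i

/-- `g^i(w^i, γ^{-i}) = ∑_{w^{-i}} g^i(w^i, w^{-i}) ∏_{j ≠ i} γ^j(w^j)`, where `j` ranges over
the other players and chance. -/
noncomputable def seqPayoffAgainst [Fintype N] (i : N) (v : G.Seq (some i))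
    (γ : G.SeqProfile) : ℝ :=
  ∑ w : ((j : Option N) → G.Seq j) with w (some i) = v,
    G.seqPayoff i w * ∏ j ∈ Finset.univ.erase (some i), planWithChance γ j (w j)

variable (G)

/-- The set `Λ^i` of realization plans of player `i`. -/
def plans (i : N) : Set (G.Seq (some i) → ℝ) :=
  {γ | γ (G.emptySeq (some i)) = 1 ∧
    (∀ I : G.Info (some i), ∑ a, γ (ext I a) = γ (seqTo I)) ∧
    ∀ (I : G.Info (some i)) (a : {a : A // a ∈ acts I}), 0 ≤ γ (ext I a)}

variable {G}

/-- `η` is a perturbation for the parameter `ε`: it satisfies the linear recursion of realization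
plans and `0 < η^i(w^i_I a) ≤ ε`. -/
def IsPerturbation (ε : ℝ) (η : G.SeqProfile) : Prop :=
  ∀ (i : N) (I : G.Info (some i)),
    (∑ a, η i (ext I a) = η i (seqTo I)) ∧
    ∀ a : {a : A // a ∈ acts I}, 0 < η i (ext I a) ∧ η i (ext I a) ≤ ε

/-- The set `Λ^i(ε)` of perturbed realization plans of player `i`: those bounded below by `η`. -/
def perturbedPlans (η : G.SeqProfile) (i : N) : Set (G.Seq (some i) → ℝ) :=
  {γ | γ ∈ G.plans i ∧ ∀ w, η i w ≤ γ w}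

/-- The objective of player `i` against the plans `γ` of the others:
`∑_{I, a} x(w^i_I a) g^i(w^i_I a, γ^{-i})`. -/
noncomputable def objective [Fintype N] (i : N) (γ : G.SeqProfile) (x : G.Seq (some i) → ℝ) : ℝ :=
  ∑ I : G.Info (some i), ∑ a : {a : A // a ∈ acts I}, x (ext I a) * seqPayoffAgainst i (ext I a) γ

/-- Nash equilibria of the perturbed game in sequence form with perturbation `η`. -/
def IsPerturbedNash [Fintype N] (η γ : G.SeqProfile) : Prop :=
  ∀ i, γ i ∈ perturbedPlans η i ∧ IsMaxOn (objective i γ) (perturbedPlans η i) (γ i)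

/-- The realization plan `γ^i(σ^i; w^i) = ∑_{s^i} s^i(w^i) σ^i(s^i)` of a mixed strategy. -/
noncomputable def planOf (σ : G.StrategyProfile) : G.SeqProfile :=
  fun i w => ∑ s : G.PureStrategy (some i), s.seqVal w * σ i s

variable (G)

/-- The set `T` of pairs of a mixed strategy profile and its realization plan profile. -/
def T : Set (G.StrategyProfile × G.SeqProfile) :=
  {p | p.1 ∈ G.mixedProfiles ∧ p.2 = planOf p.1}

end ExtensiveGame

end

/-!
A realization plan is the image of a mixed strategy under the linear map `planSum`, which sums the
weights of the pure strategies that take all actions of a sequence. Expected payoffs depend on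
mixed strategies only through their plans, and the objective of the sequence form is the expected
payoff up to a constant (`objective_planSum`). Conversely every nonnegative solution of the linear
recursion of realization plans, normalized or not, is the image of nonnegative weights on the
reduced pure strategies, positive ones if the solution is positive (`exists_planSum_eq`): they are
obtained by drawing the actions at all information sets independently.

*From perfect equilibria to perturbed games.* Given an `ε`-perfect equilibrium `τ`, let the
perturbation be the image of the weights `min ε (τ s)`. What the plan of `τ` has beyond it comes
from best responses only, and by the lifting result every competing plan is the perturbation plus
the image of nonnegative weights of the same total mass, so it is not better
(`IsEpsPerfect.isPerturbedNash`).

*From perturbed games to perfect equilibria.* Let equilibria `γ k` of the games perturbed by `η k`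
converge to the plan of `σ`. For some `θ k → 1` the plan `γ k - η k` dominates `θ k` times the plan
of `σ`. Hence `γ k` is the plan of `τ k = θ k • σ + m k + n k`, where `m k ≥ 0` lifts the remainder
and `n k > 0` lifts `η k`; since the masses of `m k` and `n k` add up to `1 - θ k`, `τ k` converges
to `σ` (`exists_lift`). Optimality of `γ k` forbids weight beyond `n k` on a pure strategy that is
not a best response (`IsPerturbedNash.eq_zero`), and `n k ≤ ε k` because `η k ≤ ε k`.
-/

section

open scoped Classical

namespace ExtensiveGame

variable {N A : Type*} {G : ExtensiveGame N A}

/-! ### Sequences under perfect recall -/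

theorem record_append (i : Option N) (h : List A) (a : A) :
    G.record i (h ++ [a]) = G.record i h ++ (G.choiceAt i (h, a)).toList := by
  rw [record, moves_append, List.filterMap_append, ← record]
  cases hc : G.choiceAt i (h, a) <;> simp [hc]

theorem choiceAt_eq_none {i : Option N} {h : List A} {a : A} (hi : G.P h ≠ i) :
    G.choiceAt i (h, a) = none :=
  dif_neg fun hm => hi (Finset.mem_filter.1 hm.1).2.2

theorem mem_nodes_of_append_mem {h : List A} {a : A} (ha : h ++ [a] ∈ G.H) :
    h ∈ G.nodes (G.P h) :=
  Finset.mem_filter.2 ⟨G.prefix_mem h a ha, ⟨a, ha⟩, rfl⟩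

theorem choiceAt_eq_some {i : Option N} {h : List A} {a : A} (hh : h ∈ G.nodes i)
    (ha : h ++ [a] ∈ G.H) :
    G.choiceAt i (h, a) = some ⟨G.infoAt i h hh, a, G.mem_acts_infoAt hh ha⟩ :=
  dif_pos ⟨hh, ha⟩

theorem eq_singleton_rep (I : G.Info none) : I.1 = {I.rep} := by
  have h2 : I.1 ∈ (⊥ : Finpartition (G.nodes none)).parts := I.2
  rw [Finpartition.mem_bot_iff] at h2
  obtain ⟨b, -, hb⟩ := h2
  have h3 := I.rep_mem
  rw [← hb, Finset.mem_singleton] at h3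
  rw [h3, hb]

theorem record_eq_seqTo (hG : G.PerfectRecall) {i : Option N} (I : G.Info i) {h : List A}
    (hh : h ∈ I.1) : G.record i h = (seqTo I).1 := by
  cases i with
  | none =>
    rw [eq_singleton_rep, Finset.mem_singleton] at hh
    rw [hh]
    rfl
  | some i => exact hG i I.1 I.2 h hh _ I.rep_mem

/-- Induction along a sequence: apart from `∅`, the sequences are exactly the extensions
`w^i_I a`. -/
theorem Seq.ext_induction (hG : G.PerfectRecall) {i : Option N} {p : G.Seq i → Prop}
    (empty : p (G.emptySeq i)) (ext : ∀ I a, p (seqTo I) → p (ext I a)) (w : G.Seq i) : p w := by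
  have key : ∀ (h : List A) (hh : h ∈ G.H), p ⟨G.record i h, Finset.mem_image_of_mem _ hh⟩ := by
    intro h
    induction h using List.reverseRecOn with
    | nil => exact fun _ => empty
    | append_singleton h a ih =>
      intro ha
      have ih := ih (G.prefix_mem h a ha)
      by_cases hi : G.P h = i
      · subst hi
        have hn := mem_nodes_of_append_mem ha
        have hI := record_eq_seqTo hG (G.infoAt _ h hn) ((G.partition _).mem_part hn)
        have e1 : (⟨G.record _ h, Finset.mem_image_of_mem _ (G.prefix_mem h a ha)⟩ :
            G.Seq (G.P h)) = seqTo (G.infoAt _ h hn) := Subtype.ext hI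
        rw [e1] at ih
        convert ext _ ⟨a, G.mem_acts_infoAt hn ha⟩ ih using 1
        apply Subtype.ext
        simp only [ExtensiveGame.ext, record_append, choiceAt_eq_some hn ha, hI,
          Option.toList_some]
      · convert ih using 1
        apply Subtype.ext
        simp [record_append, choiceAt_eq_none hi]
  obtain ⟨w, hw⟩ := w
  obtain ⟨h, hh, rfl⟩ := Finset.mem_image.1 hw
  exact key h hh

/-- What precedes a choice in a sequence is the sequence leading to its information set. -/
theorem Seq.prefix_eq (hG : G.PerfectRecall) {i : Option N} (w : G.Seq i) :
    ∀ (l₁ : List (G.Choice i)) (c : G.Choice i) (l₂ : List (G.Choice i)),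
      w.1 = l₁ ++ c :: l₂ → l₁ = (seqTo c.1).1 := by
  induction w using Seq.ext_induction hG with
  | empty => intro l₁ c l₂ h; simp [emptySeq] at h
  | ext I a ih =>
    intro l₁ c l₂ h
    rcases List.eq_nil_or_concat' l₂ with rfl | ⟨l, b, rfl⟩
    · obtain ⟨h1, h2⟩ := List.append_inj' h (by simp)
      simp only [List.cons.injEq, and_true] at h2
      rw [← h1, ← h2]
    · refine ih l₁ c l ?_
      have h' : (seqTo I).1 ++ [⟨I, a⟩] = (l₁ ++ c :: l) ++ [b] := by
        simpa [ExtensiveGame.ext] using h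
      exact (List.append_inj' h' (by simp)).1

/-- A sequence contains, with a choice, the sequence leading to it. -/
theorem Seq.mem_of_mem_seqTo (hG : G.PerfectRecall) {i : Option N} (w : G.Seq i)
    {c d : G.Choice i} (hc : c ∈ w.1) (hd : d ∈ (seqTo c.1).1) : d ∈ w.1 := by
  obtain ⟨l₁, l₂, h⟩ := List.append_of_mem hc
  rw [← w.prefix_eq hG _ _ _ h] at hd
  rw [h]
  exact List.mem_append_left _ hd

theorem length_seqTo_lt (hG : G.PerfectRecall) {i : Option N} {w : G.Seq i}
    {c : G.Choice i} (hc : c ∈ w.1) : (seqTo c.1).1.length < w.1.length := by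
  obtain ⟨l₁, l₂, h⟩ := List.append_of_mem hc
  rw [← w.prefix_eq hG _ _ _ h, h]
  simp

theorem Seq.nodup_infos (hG : G.PerfectRecall) {i : Option N} (w : G.Seq i) :
    (w.1.map Sigma.fst).Nodup := by
  induction w using Seq.ext_induction hG with
  | empty => simp [emptySeq]
  | ext I a ih =>
    simp only [ExtensiveGame.ext, List.map_append, List.map_cons, List.map_nil]
    refine List.Nodup.append ih (List.nodup_singleton _) ?_
    intro J hJ hJ'
    obtain ⟨c, hc, rfl⟩ := List.mem_map.1 hJ
    have := length_seqTo_lt hG hc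
    rw [List.mem_singleton.1 hJ'] at this
    exact lt_irrefl _ this

theorem exists_seqTo_eq_nil (hG : G.PerfectRecall) {i : Option N} [Nonempty (G.Info i)] :
    ∃ I : G.Info i, seqTo I = G.emptySeq i := by
  obtain ⟨I, hI⟩ := Finite.exists_min fun I : G.Info i => (seqTo I).1.length
  refine ⟨I, Subtype.ext (List.eq_nil_iff_forall_not_mem.2 fun c hc => ?_)⟩
  exact absurd (length_seqTo_lt hG hc) (not_lt.2 (hI c.1))

theorem ext_injective {i : Option N} :
    Function.Injective fun c : G.Choice i => ext c.1 c.2 := by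
  intro c d h
  simpa using (List.append_inj' (Subtype.ext_iff.1 h) (by simp)).2

theorem ext_ne_emptySeq {i : Option N} (I : G.Info i) (a : {a : A // a ∈ acts I}) :
    ext I a ≠ G.emptySeq i := by
  intro h
  simpa [ext, emptySeq] using Subtype.ext_iff.1 h

/-- Summation over sequences: apart from `∅` they are the `w^i_I a`, each obtained once. -/
theorem sum_seq (hG : G.PerfectRecall) {i : Option N} (F : G.Seq i → ℝ) :
    ∑ w, F w = F (G.emptySeq i) + ∑ I : G.Info i, ∑ a, F (ext I a) := by
  rw [← Fintype.sum_sigma' fun (I : G.Info i) a => F (ext I a),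
    ← Finset.add_sum_erase _ _ (Finset.mem_univ (G.emptySeq i))]
  congr 1
  symm
  refine Finset.sum_bij (fun c _ => ext c.1 c.2) ?_ ?_ ?_ ?_
  · exact fun c _ => Finset.mem_erase.2 ⟨ext_ne_emptySeq _ _, Finset.mem_univ _⟩
  · exact fun c _ d _ h => ext_injective h
  · intro w hw
    have hw := (Finset.mem_erase.1 hw).1
    induction w using Seq.ext_induction hG with
    | empty => exact absurd rfl hw
    | ext I a _ => exact ⟨⟨I, a⟩, Finset.mem_univ _, rfl⟩
  · exact fun _ _ => rfl

instance acts_nonempty {i : Option N} (I : G.Info i) : Nonempty {a : A // a ∈ acts I} := by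
  obtain ⟨a, ha⟩ := (Finset.mem_filter.1 I.rep_mem_nodes).2.1
  exact ⟨a, Finset.mem_biUnion.2 ⟨_, I.rep_mem, G.mem_actions.2 ha⟩⟩

/-! ### Pure strategies and behaviour -/

theorem PureStrategy.seqVal_eq {i : Option N} (s : G.PureStrategy i) (w : G.Seq i) :
    s.seqVal w = if ∀ c ∈ w.1, s.1 c.1 = some c.2 then 1 else 0 := by
  unfold PureStrategy.seqVal PureStrategy.val
  induction w.1 with
  | nil => simp
  | cons c l ih =>
    rw [List.map_cons, List.prod_cons, ih]
    by_cases hc : s.1 c.1 = some c.2 <;> simp [hc]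

theorem PureStrategy.seqVal_nonneg {i : Option N} (s : G.PureStrategy i) (w : G.Seq i) :
    0 ≤ s.seqVal w := by
  rw [s.seqVal_eq]
  split_ifs <;> simp

theorem PureStrategy.seqVal_emptySeq {i : Option N} (s : G.PureStrategy i) :
    s.seqVal (G.emptySeq i) = 1 := by
  simp [PureStrategy.seqVal, emptySeq]

theorem PureStrategy.seqVal_ext {i : Option N} (s : G.PureStrategy i) (I : G.Info i)
    (a : {a : A // a ∈ acts I}) : s.seqVal (ext I a) = s.seqVal (seqTo I) * s.val ⟨I, a⟩ := by
  simp [PureStrategy.seqVal, ext]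

/-- The indicator of a pure strategy satisfies the recursion of realization plans. -/
theorem PureStrategy.sum_seqVal_ext {i : N} (s : G.PureStrategy (some i)) (I : G.Info (some i)) :
    ∑ a, s.seqVal (ext I a) = s.seqVal (seqTo I) := by
  simp_rw [s.seqVal_ext, ← Finset.mul_sum]
  by_cases h : ∀ c ∈ (seqTo I).1, s.1 c.1 = some c.2
  · obtain ⟨b, hb⟩ := Option.isSome_iff_exists.1 ((s.2 I).2 (Or.inr h))
    simp [PureStrategy.val, hb]
  · simp [s.seqVal_eq, h]

/-- Two reduced pure strategies that agree wherever both prescribe an action are equal. -/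
theorem PureStrategy.eq_of_agree (hG : G.PerfectRecall) {i : N} {s s' : G.PureStrategy (some i)}
    (h : ∀ I a a', s.1 I = some a → s'.1 I = some a' → a = a') : s = s' := by
  have key : ∀ (n : ℕ) (I : G.Info (some i)), (seqTo I).1.length < n → s.1 I = s'.1 I := by
    intro n
    induction n with
    | zero => exact fun I hI => absurd hI (Nat.not_lt_zero _)
    | succ n ih =>
      intro I hI
      have h1 : (s.1 I).isSome = true ↔ (s'.1 I).isSome = true := by
        rw [s.2 I, s'.2 I]
        refine or_congr Iff.rfl (forall₂_congr fun c hc => ?_)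
        rw [ih c.1 (by have := length_seqTo_lt hG hc; omega)]
      cases hs : s.1 I <;> cases hs' : s'.1 I <;> simp [hs, hs'] at h1 ⊢
      exact h I _ _ hs hs'
  exact Subtype.ext (funext fun I => key _ I (Nat.lt_succ_self _))

/-- An unreduced pure strategy prescribes an action at every information set. -/
abbrev FullStrategy (G : ExtensiveGame N A) (i : Option N) : Type _ :=
  (I : G.Info i) → {a : A // a ∈ acts I}

/-- Behavioural randomization: if the actions at the information sets are drawn independently
according to `β`, the probability that all actions of a sequence are taken is the product of
their probabilities. -/
theorem sum_fullStrategy_prod (hG : G.PerfectRecall) {i : Option N}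
    (β : (I : G.Info i) → {a : A // a ∈ acts I} → ℝ) (hβ : ∀ I, ∑ a, β I a = 1)
    (w : G.Seq i) :
    ∑ t : G.FullStrategy i, (if ∀ c ∈ w.1, t c.1 = c.2 then 1 else 0) * ∏ I, β I (t I) =
      (w.1.map fun c => β c.1 c.2).prod := by
  have key : ∀ l : List (G.Choice i), (l.map Sigma.fst).Nodup →
      ∃ b : (I : G.Info i) → {a : A // a ∈ acts I} → ℝ,
        (∀ I, I ∉ l.map Sigma.fst → b I = β I) ∧
        (∀ t : G.FullStrategy i, (if ∀ c ∈ l, t c.1 = c.2 then 1 else 0) * ∏ I, β I (t I) =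
          ∏ I, b I (t I)) ∧
        ∏ I, ∑ a, b I a = (l.map fun c => β c.1 c.2).prod := by
    intro l
    induction l with
    | nil => exact fun _ => ⟨β, by simp [-Finset.univ_eq_attach, hβ]⟩
    | cons c l ih =>
      intro hl
      rw [List.map_cons, List.nodup_cons] at hl
      obtain ⟨b, hb1, hb2, hb3⟩ := ih hl.2
      have hbc := hb1 _ hl.1
      refine ⟨Function.update b c.1 fun a => if a = c.2 then β c.1 a else 0, ?_, ?_, ?_⟩
      · intro I hI
        simp only [List.map_cons, List.mem_cons, not_or] at hI
        rw [Function.update_of_ne hI.1, hb1 I hI.2]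
      · intro t
        have hrest : ∏ I ∈ Finset.univ.erase c.1,
            Function.update b c.1 (fun a => if a = c.2 then β c.1 a else 0) I (t I) =
            ∏ I ∈ Finset.univ.erase c.1, b I (t I) := by
          refine Finset.prod_congr rfl fun I hI => ?_
          rw [Function.update_of_ne (Finset.ne_of_mem_erase hI)]
        have h2 := hb2 t
        rw [← Finset.mul_prod_erase Finset.univ (fun I => b I (t I)) (Finset.mem_univ c.1),
          hbc] at h2
        rw [← Finset.mul_prod_erase Finset.univ (fun I => Function.update b c.1 _ I (t I))
          (Finset.mem_univ c.1), hrest, Function.update_self]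
        by_cases hc : t c.1 = c.2
        · rw [if_pos hc, ← h2]
          simp only [List.forall_mem_cons, hc, true_and]
        · simp [hc]
      · have hrest : ∏ I ∈ Finset.univ.erase c.1, ∑ a,
            Function.update b c.1 (fun a => if a = c.2 then β c.1 a else 0) I a =
            ∏ I ∈ Finset.univ.erase c.1, ∑ a, b I a := by
          refine Finset.prod_congr rfl fun I hI => ?_
          rw [Function.update_of_ne (Finset.ne_of_mem_erase hI)]
        rw [← Finset.mul_prod_erase _ _ (Finset.mem_univ c.1), hbc, hβ, one_mul] at hb3
        rw [← Finset.mul_prod_erase _ _ (Finset.mem_univ c.1), hrest, Function.update_self, hb3]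
        simp [-Finset.univ_eq_attach]
  obtain ⟨b, -, hb2, hb3⟩ := key w.1 (w.nodup_infos hG)
  rw [Finset.sum_congr rfl fun t _ => hb2 t, ← hb3, Finset.prod_univ_sum]
  rw [Fintype.piFinset_univ]

/-! ### The plan of chance -/

theorem exists_eq_some (s : G.PureStrategy none) (I : G.Info none) : ∃ a, s.1 I = some a :=
  Option.isSome_iff_exists.1 ((s.2 I).2 (Or.inl rfl))

theorem chanceMixed_eq (s : G.PureStrategy none) (t : G.FullStrategy none)
    (h : ∀ I, s.1 I = some (t I)) : G.chanceMixed s = ∏ I, ∏ b ∈ I.1, G.f b (t I).1 := by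
  unfold chanceMixed
  refine Finset.prod_bij' (fun b hb => G.infoAt none b hb) (fun I _ => I.rep) (by simp)
    (fun I _ => I.rep_mem_nodes) ?_ (fun I _ => I.infoAt_rep) ?_
  · intro b hb
    have h1 := (G.partition none).mem_part hb
    have h2 := eq_singleton_rep (G.infoAt none b hb)
    exact (Finset.mem_singleton.1 (h2 ▸ h1)).symm
  · intro b hb
    have h1 : b ∈ (G.infoAt none b hb).1 := (G.partition none).mem_part hb
    have h2 : (G.infoAt none b hb).1 = {b} := by
      rw [eq_singleton_rep, Finset.mem_singleton] at h1
      rw [eq_singleton_rep, ← h1]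
    have h3 : (t (G.infoAt none b hb)).1 ∈ G.actions b := by
      obtain ⟨b', hb', hab⟩ := Finset.mem_biUnion.1 (t (G.infoAt none b hb)).2
      rw [h2, Finset.mem_singleton] at hb'
      rwa [hb'] at hab
    rw [h2, Finset.prod_singleton, Finset.sum_eq_single_of_mem _ h3]
    · rw [choiceAt_eq_some hb (G.mem_actions.1 h3)]
      simp [PureStrategy.val, h]
    · intro a ha hne
      rw [choiceAt_eq_some hb (G.mem_actions.1 ha), Option.elim_some, PureStrategy.val, h, if_neg,
        zero_mul]
      intro he
      exact hne (congrArg Subtype.val (Option.some.inj he)).symm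

/-- The mixed strategy of chance realizes the plan of chance. -/
theorem sum_seqVal_mul_chanceMixed (hG : G.PerfectRecall) (w : G.Seq none) :
    ∑ s : G.PureStrategy none, s.seqVal w * G.chanceMixed s = G.chancePlan w := by
  have hβ : ∀ I : G.Info none, ∑ a : {a : A // a ∈ acts I}, ∏ b ∈ I.1, G.f b a.1 = 1 := by
    intro I
    have h1 := G.f_sum I.rep I.rep_mem_nodes
    have h2 : acts I = G.actions I.rep := by
      rw [acts, eq_singleton_rep, Finset.singleton_biUnion]
    rw [← h2, ← Finset.sum_coe_sort] at h1
    rw [← h1]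
    refine Finset.sum_congr rfl fun a _ => ?_
    rw [eq_singleton_rep, Finset.prod_singleton]
  rw [chancePlan, ← sum_fullStrategy_prod hG (fun I a => ∏ b ∈ I.1, G.f b a.1) hβ w]
  refine Finset.sum_bij' (fun s _ I => (exists_eq_some s I).choose)
    (fun t _ => ⟨fun I => some (t I), by simp⟩) (by simp) (by simp) ?_ ?_ ?_
  · intro s _
    exact Subtype.ext (funext fun I => ((exists_eq_some s I).choose_spec).symm)
  · intro t _
    funext I
    exact (Option.some.inj (exists_eq_some ⟨fun I => some (t I), by simp⟩ I).choose_spec).symm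
  · intro s _
    rw [chanceMixed_eq s _ fun I => (exists_eq_some s I).choose_spec, s.seqVal_eq]
    congr 2
    refine propext (forall₂_congr fun c _ => ?_)
    rw [(exists_eq_some s c.1).choose_spec, Option.some.injEq]

/-! ### Mixed strategies realizing a plan -/

/-- The weights that the weights `m` on pure strategies induce on sequences; `planOf σ i` is
`planSum (σ i)`. -/
noncomputable def planSum {i : N} (m : G.PureStrategy (some i) → ℝ) (w : G.Seq (some i)) : ℝ :=
  ∑ s, s.seqVal w * m s

theorem planSum_nonneg {i : N} {m : G.PureStrategy (some i) → ℝ} (hm : ∀ s, 0 ≤ m s)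
    (w : G.Seq (some i)) : 0 ≤ planSum m w :=
  Finset.sum_nonneg fun s _ => mul_nonneg (s.seqVal_nonneg w) (hm s)

theorem planSum_emptySeq {i : N} (m : G.PureStrategy (some i) → ℝ) :
    planSum m (G.emptySeq (some i)) = ∑ s, m s := by
  simp [planSum, PureStrategy.seqVal_emptySeq]

theorem planSum_add {i : N} (m n : G.PureStrategy (some i) → ℝ) :
    planSum (m + n) = planSum m + planSum n := by
  funext w
  simp [planSum, mul_add, Finset.sum_add_distrib]

theorem planSum_smul {i : N} (θ : ℝ) (m : G.PureStrategy (some i) → ℝ) :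
    planSum (θ • m) = θ • planSum m := by
  funext w
  simp [planSum, Finset.mul_sum, mul_left_comm]

/-- Homogeneous realization plans: the linear recursion without the normalization at `∅`. -/
def IsRecursive {i : N} (x : G.Seq (some i) → ℝ) : Prop :=
  ∀ I : G.Info (some i), ∑ a, x (ext I a) = x (seqTo I)

theorem isRecursive_planSum {i : N} (m : G.PureStrategy (some i) → ℝ) :
    IsRecursive (planSum m) := by
  intro I
  simp only [planSum]
  rw [Finset.sum_comm]
  refine Finset.sum_congr rfl fun s _ => ?_
  rw [← Finset.sum_mul, s.sum_seqVal_ext]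

theorem IsRecursive.sub {i : N} {x y : G.Seq (some i) → ℝ} (hx : IsRecursive x)
    (hy : IsRecursive y) : IsRecursive (x - y) := by
  intro I
  simp only [Pi.sub_apply, Finset.sum_sub_distrib, hx I, hy I]

theorem IsRecursive.smul {i : N} {x : G.Seq (some i) → ℝ} (θ : ℝ) (hx : IsRecursive x) :
    IsRecursive (θ • x) := by
  intro I
  simp only [Pi.smul_apply, smul_eq_mul, ← Finset.mul_sum, hx I]

/-- The reduced pure strategy of an unreduced one: the prescriptions at information sets that
the strategy itself excludes are forgotten. -/
noncomputable def reduce (hG : G.PerfectRecall) {i : N} (t : G.FullStrategy (some i)) :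
    G.PureStrategy (some i) :=
  ⟨fun I => if ∀ c ∈ (seqTo I).1, t c.1 = c.2 then some (t I) else none, by
    intro I
    have h : ∀ c ∈ (seqTo I).1, (if ∀ d ∈ (seqTo c.1).1, t d.1 = d.2 then some (t c.1) else none) =
        some c.2 ↔ (∀ d ∈ (seqTo c.1).1, t d.1 = d.2) ∧ t c.1 = c.2 := by
      intro c _
      split_ifs with h
      · exact Option.some_inj.trans (and_iff_right h).symm
      · simp [h]
    simp only [reduceCtorEq, false_or]
    rw [forall₂_congr h]
    constructor
    · intro hI c hc
      have hI : ∀ c ∈ (seqTo I).1, t c.1 = c.2 := by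
        by_contra hne
        simp [hne] at hI
      exact ⟨fun d hd => hI d (Seq.mem_of_mem_seqTo hG _ hc hd), hI c hc⟩
    · intro hI
      rw [if_pos fun c hc => (hI c hc).2]
      rfl⟩

theorem reduce_eq_some_iff (hG : G.PerfectRecall) {i : N} (t : G.FullStrategy (some i))
    (I : G.Info (some i)) (a : {a : A // a ∈ acts I}) :
    (reduce hG t).1 I = some a ↔ (∀ c ∈ (seqTo I).1, t c.1 = c.2) ∧ t I = a := by
  simp only [reduce]
  split_ifs with h
  · exact Option.some_inj.trans (and_iff_right h).symm
  · simp [h]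

theorem seqVal_reduce (hG : G.PerfectRecall) {i : N} (t : G.FullStrategy (some i))
    (w : G.Seq (some i)) :
    (reduce hG t).seqVal w = if ∀ c ∈ w.1, t c.1 = c.2 then 1 else 0 := by
  rw [PureStrategy.seqVal_eq]
  congr 1
  refine propext ⟨fun h c hc => ((reduce_eq_some_iff hG t _ _).1 (h c hc)).2, fun h c hc => ?_⟩
  exact (reduce_eq_some_iff hG t _ _).2
    ⟨fun d hd => h d (w.mem_of_mem_seqTo hG hc hd), h c hc⟩

theorem reduce_surjective (hG : G.PerfectRecall) {i : N} :
    Function.Surjective (reduce hG (i := i)) := by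
  intro s
  refine ⟨fun I => (s.1 I).getD (Classical.arbitrary _), PureStrategy.eq_of_agree hG ?_⟩
  intro I a a' ha ha'
  have := ((reduce_eq_some_iff hG _ _ _).1 ha).2
  rw [← this, ha', Option.getD_some]

/-- Kuhn's theorem for homogeneous plans: a nonnegative solution of the recursion is realized by
nonnegative weights on the reduced pure strategies, positive ones if the solution is positive. -/
theorem exists_planSum_eq (hG : G.PerfectRecall) {i : N} {x : G.Seq (some i) → ℝ}
    (hx : IsRecursive x) (h0 : ∀ w, 0 ≤ x w) :
    ∃ m : G.PureStrategy (some i) → ℝ, (∀ s, 0 ≤ m s) ∧ planSum m = x ∧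
      ((∀ w, 0 < x w) → ∀ s, 0 < m s) := by
  -- behaviour at information sets of weight `0` is irrelevant: the uniform distribution is used
  let β : (I : G.Info (some i)) → {a : A // a ∈ acts I} → ℝ := fun I a =>
    if x (seqTo I) = 0 then (Fintype.card {a : A // a ∈ acts I} : ℝ)⁻¹
    else x (ext I a) / x (seqTo I)
  have hβ0 : ∀ I a, 0 ≤ β I a := by
    intro I a
    simp only [β]
    split_ifs
    · positivity
    · exact div_nonneg (h0 _) (h0 _)
  have hβ1 : ∀ I, ∑ a, β I a = 1 := by
    intro I
    simp only [β]
    split_ifs with h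
    · rw [Finset.sum_const, Finset.card_univ, nsmul_eq_mul, mul_inv_cancel₀]
      exact Nat.cast_ne_zero.2 Fintype.card_ne_zero
    · rw [← Finset.sum_div, hx I, div_self h]
  have hβx : ∀ I a, x (seqTo I) * β I a = x (ext I a) := by
    intro I a
    simp only [β]
    split_ifs with h
    · have h1 := hx I
      rw [h, Finset.sum_eq_zero_iff_of_nonneg fun a _ => h0 _] at h1
      rw [h, h1 a (Finset.mem_univ a), zero_mul]
    · exact mul_div_cancel₀ _ h
  have hprod : ∀ w : G.Seq (some i),
      x (G.emptySeq (some i)) * (w.1.map fun c => β c.1 c.2).prod = x w := by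
    intro w
    induction w using Seq.ext_induction hG with
    | empty => simp [emptySeq]
    | ext I a ih =>
      rw [← hβx, ← ih]
      simp [ext, mul_assoc]
  refine ⟨fun s => x (G.emptySeq (some i)) *
    ∑ t : G.FullStrategy (some i) with reduce hG t = s, ∏ I, β I (t I), ?_, ?_, ?_⟩
  · exact fun s => mul_nonneg (h0 _) (Finset.sum_nonneg fun t _ =>
      Finset.prod_nonneg fun I _ => hβ0 _ _)
  · funext w
    rw [← hprod w, ← sum_fullStrategy_prod hG β hβ1 w,
      ← Finset.sum_fiberwise Finset.univ (reduce hG), Finset.mul_sum, planSum]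
    refine Finset.sum_congr rfl fun s _ => ?_
    rw [mul_left_comm, Finset.mul_sum]
    congr 1
    refine Finset.sum_congr rfl fun t ht => ?_
    rw [← (Finset.mem_filter.1 ht).2, seqVal_reduce]
  · intro hpos s
    obtain ⟨t, ht⟩ := reduce_surjective hG s
    refine mul_pos (hpos _) (Finset.sum_pos (fun t _ => Finset.prod_pos fun I _ => ?_)
      ⟨t, Finset.mem_filter.2 ⟨Finset.mem_univ _, ht⟩⟩)
    simp only [β]
    rw [if_neg (hpos _).ne']
    exact div_pos (hpos _) (hpos _)

/-! ### Payoffs in the normal form and in the sequence form -/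

/-- The sequence `w^j_h` at a terminal history `h`. -/
noncomputable def terminalSeq (h : {h // h ∈ G.Z}) (j : Option N) : G.Seq j :=
  ⟨G.record j h.1, Finset.mem_image_of_mem _ (Finset.mem_filter.1 h.2).1⟩

/-- The product of the moves along a history, regrouped by players. -/
theorem prod_moves [Fintype N] (s : (j : Option N) → G.PureStrategy j) (h : List A)
    (hh : h ∈ G.H) :
    ((moves h).map fun m => (G.choiceAt (G.P m.1) m).elim 0 (s (G.P m.1)).val).prod =
      ∏ j, ((G.record j h).map (s j).val).prod := by
  induction h using List.reverseRecOn with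
  | nil => simp [moves, record]
  | append_singleton h a ih =>
    rw [moves_append, List.map_append, List.prod_append, ih (G.prefix_mem h a hh)]
    simp_rw [record_append, List.map_append, List.prod_append]
    rw [Finset.prod_mul_distrib]
    congr 1
    rw [Fintype.prod_eq_single (G.P h)]
    · simp [choiceAt_eq_some (mem_nodes_of_append_mem hh) hh]
    · intro j hj
      simp [choiceAt_eq_none hj.symm]

theorem purePayoff_eq [Fintype N] (i : N) (s : (j : Option N) → G.PureStrategy j) :
    G.purePayoff i s =
      ∑ h : {h // h ∈ G.Z}, G.payoff i h.1 * ∏ j, (s j).seqVal (terminalSeq h j) := by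
  rw [purePayoff, ← Finset.sum_coe_sort]
  refine Finset.sum_congr rfl fun h _ => ?_
  rw [prod_moves s _ (Finset.mem_filter.1 h.2).1]
  rfl

theorem seqPayoff_eq (i : N) (w : (j : Option N) → G.Seq j) :
    G.seqPayoff i w = ∑ h : {h // h ∈ G.Z}, if terminalSeq h = w then G.payoff i h.1 else 0 := by
  rw [seqPayoff, Finset.sum_filter, ← Finset.sum_coe_sort]
  refine Finset.sum_congr rfl fun h _ => ?_
  congr 1
  simp only [funext_iff, Subtype.ext_iff, terminalSeq]

theorem seqPayoffAgainst_eq [Fintype N] (i : N) (v : G.Seq (some i)) (γ : G.SeqProfile) :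
    seqPayoffAgainst i v γ = ∑ h : {h // h ∈ G.Z}, if terminalSeq h (some i) = v then
      G.payoff i h.1 * ∏ j ∈ Finset.univ.erase (some i), planWithChance γ j (terminalSeq h j)
      else 0 := by
  unfold seqPayoffAgainst
  simp_rw [seqPayoff_eq, Finset.sum_mul]
  rw [Finset.sum_comm]
  refine Finset.sum_congr rfl fun h _ => ?_
  simp_rw [ite_mul, zero_mul]
  rw [Finset.sum_ite_eq]
  simp

/-- Every player's mixed strategy, and that of chance, realizes the corresponding plan. -/
theorem sum_seqVal_mul_withChance (hG : G.PerfectRecall) (σ : G.StrategyProfile) (j : Option N)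
    (w : G.Seq j) : ∑ s, s.seqVal w * withChance σ j s = planWithChance (planOf σ) j w := by
  cases j with
  | none => exact sum_seqVal_mul_chanceMixed hG w
  | some i => rfl

theorem payoffAgainst_eq [Fintype N] (hG : G.PerfectRecall) (i : N)
    (s : G.PureStrategy (some i)) (σ : G.StrategyProfile) :
    payoffAgainst i s σ = ∑ h : {h // h ∈ G.Z}, s.seqVal (terminalSeq h (some i)) *
      (G.payoff i h.1 *
        ∏ j ∈ Finset.univ.erase (some i), planWithChance (planOf σ) j (terminalSeq h j)) := by
  unfold payoffAgainst
  simp_rw [purePayoff_eq, Finset.sum_mul]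
  rw [Finset.sum_comm]
  refine Finset.sum_congr rfl fun h _ => ?_
  -- the factor of player `i` is replaced by one that fixes her strategy to be `s`
  let φ : (j : Option N) → G.PureStrategy j → ℝ := Function.update
    (fun j x => x.seqVal (terminalSeq h j) * withChance σ j x) (some i)
    fun x => if x = s then x.seqVal (terminalSeq h (some i)) else 0
  have hφ : ∀ j ∈ Finset.univ.erase (some i),
      φ j = fun x => x.seqVal (terminalSeq h j) * withChance σ j x := fun j hj =>
    Function.update_of_ne (Finset.ne_of_mem_erase hj) _ _
  have hφi : φ (some i) = fun x => if x = s then x.seqVal (terminalSeq h (some i)) else 0 :=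
    Function.update_self _ _ _
  have hsum : ∑ t : ((j : Option N) → G.PureStrategy j), ∏ j, φ j (t j) =
      s.seqVal (terminalSeq h (some i)) *
        ∏ j ∈ Finset.univ.erase (some i), planWithChance (planOf σ) j (terminalSeq h j) := by
    rw [← Fintype.piFinset_univ, ← Finset.prod_univ_sum,
      ← Finset.mul_prod_erase _ _ (Finset.mem_univ (some i)), hφi, Finset.sum_ite_eq',
      if_pos (Finset.mem_univ _)]
    congr 1
    refine Finset.prod_congr rfl fun j hj => ?_
    rw [← sum_seqVal_mul_withChance hG, hφ j hj]
  rw [mul_left_comm, ← hsum, Finset.mul_sum, Finset.sum_filter]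
  refine Finset.sum_congr rfl fun t _ => ?_
  rw [← Finset.mul_prod_erase Finset.univ (fun j => φ j (t j)) (Finset.mem_univ (some i)),
    ← Finset.mul_prod_erase Finset.univ (fun j => (t j).seqVal _) (Finset.mem_univ (some i)), hφi]
  beta_reduce
  by_cases ht : t (some i) = s
  · rw [if_pos ht, if_pos ht, mul_assoc, mul_assoc, ← Finset.prod_mul_distrib]
    congr 2
    exact Finset.prod_congr rfl fun j hj => by rw [hφ j hj]
  · simp [ht]

theorem payoffAgainst_eq_sum_seq [Fintype N] (hG : G.PerfectRecall) (i : N)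
    (s : G.PureStrategy (some i)) (σ : G.StrategyProfile) :
    payoffAgainst i s σ = ∑ v, s.seqVal v * seqPayoffAgainst i v (planOf σ) := by
  simp_rw [payoffAgainst_eq hG, seqPayoffAgainst_eq, Finset.mul_sum]
  rw [Finset.sum_comm]
  refine Finset.sum_congr rfl fun h _ => ?_
  simp_rw [mul_ite, mul_zero]
  symm
  refine (Fintype.sum_eq_single (terminalSeq h (some i)) fun v hv => ?_).trans ?_
  · exact if_neg hv.symm
  · exact if_pos rfl

/-- The objective of the sequence form is the expected payoff in the normal form, up to the
payoff at terminal histories at which `i` has not moved, which no plan of `i` can influence. -/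
theorem objective_planSum [Fintype N] (hG : G.PerfectRecall) (i : N)
    (m : G.PureStrategy (some i) → ℝ) (σ : G.StrategyProfile) :
    objective i (planOf σ) (planSum m) =
      ∑ s, m s * payoffAgainst i s σ -
        (∑ s, m s) * seqPayoffAgainst i (G.emptySeq (some i)) (planOf σ) := by
  have h := sum_seq hG fun v => planSum m v * seqPayoffAgainst i v (planOf σ)
  rw [planSum_emptySeq] at h
  rw [objective, ← sub_eq_iff_eq_add'.2 h]
  congr 1
  simp_rw [payoffAgainst_eq_sum_seq hG, planSum, Finset.sum_mul, Finset.mul_sum]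
  rw [Finset.sum_comm]
  exact Finset.sum_congr rfl fun s _ => Finset.sum_congr rfl fun v _ => by ring

theorem planSum_mem_plans {i : N} {m : G.PureStrategy (some i) → ℝ}
    (h0 : ∀ s, 0 ≤ m s) (h1 : ∑ s, m s = 1) : planSum m ∈ G.plans i :=
  ⟨by rw [planSum_emptySeq, h1], isRecursive_planSum m, fun _ _ => planSum_nonneg h0 _⟩

/-! ### From perfect equilibria to perturbed games -/

/-- The perturbation induced by cutting the weights of an `ε`-perfect equilibrium off at `ε`: a
pure strategy that is not a best response has all of its weight in the perturbation. -/
noncomputable def cutoff (ε : ℝ) (τ : G.StrategyProfile) : G.SeqProfile :=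
  fun i => planSum fun s => min ε (τ i s)

theorem isPerturbation_cutoff [Fintype N] (hG : G.PerfectRecall) {ε : ℝ} (hε : 0 < ε)
    {τ : G.StrategyProfile} (hτ : ∀ i s, 0 < τ i s) :
    IsPerturbation ((1 + ∑ i, (Nat.card (G.PureStrategy (some i)) : ℝ)) * ε)
      (cutoff ε τ) := by
  intro i I
  refine ⟨isRecursive_planSum _ I, fun a => ⟨?_, ?_⟩⟩
  · -- some pure strategy takes all the actions in `w^i_I a`
    obtain ⟨s, hs⟩ : ∃ s : G.PureStrategy (some i), s.seqVal (ext I a) = 1 := by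
      by_contra! hne
      let t : G.FullStrategy (some i) := fun J =>
        if h : ∃ b, (⟨J, b⟩ : G.Choice (some i)) ∈ (ext I a).1 then h.choose
        else Classical.arbitrary _
      refine hne (reduce hG t) ?_
      rw [seqVal_reduce, if_pos]
      rintro ⟨J, b⟩ hc
      have h : ∃ b, (⟨J, b⟩ : G.Choice (some i)) ∈ (ext I a).1 := ⟨b, hc⟩
      have := List.inj_on_of_nodup_map (Seq.nodup_infos hG (ext I a)) h.choose_spec hc rfl
      simp only [t, dif_pos h]
      simpa using this
    refine Finset.sum_pos' (fun s _ => mul_nonneg (s.seqVal_nonneg _)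
      (le_min hε.le (hτ i s).le)) ⟨s, Finset.mem_univ _, ?_⟩
    rw [hs, one_mul]
    exact lt_min hε (hτ i s)
  · calc cutoff ε τ i (ext I a) ≤ ∑ _s : G.PureStrategy (some i), ε := by
          refine Finset.sum_le_sum fun s _ => ?_
          rw [s.seqVal_eq]
          split_ifs
          · rw [one_mul]; exact min_le_left _ _
          · rw [zero_mul]; exact hε.le
      _ = Nat.card (G.PureStrategy (some i)) * ε := by
          rw [Finset.sum_const, Finset.card_univ, nsmul_eq_mul, Nat.card_eq_fintype_card]
      _ ≤ _ := by
          refine mul_le_mul_of_nonneg_right ?_ hε.le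
          have := Finset.single_le_sum (f := fun i => (Nat.card (G.PureStrategy (some i)) : ℝ))
            (fun _ _ => Nat.cast_nonneg _) (Finset.mem_univ i)
          linarith

theorem IsEpsPerfect.isPerturbedNash [Fintype N] (hG : G.PerfectRecall) {ε : ℝ}
    {τ : G.StrategyProfile} (h : IsEpsPerfect ε τ) :
    IsPerturbedNash (cutoff ε τ) (planOf τ) := by
  obtain ⟨hmix, -, hbest⟩ := h
  intro i
  set η : G.PureStrategy (some i) → ℝ := fun s => min ε (τ i s)
  have hle : ∀ w, cutoff ε τ i w ≤ planOf τ i w := fun w => Finset.sum_le_sum fun s _ =>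
    mul_le_mul_of_nonneg_left (min_le_right _ _) (s.seqVal_nonneg w)
  refine ⟨⟨planSum_mem_plans (hmix i).1 (hmix i).2, hle⟩, ?_⟩
  intro x ⟨hx, hηx⟩
  -- what `x` adds to the perturbation is realized by weights on pure strategies
  obtain ⟨m, hm0, hm, -⟩ := exists_planSum_eq hG
    (IsRecursive.sub hx.2.1 (isRecursive_planSum η)) fun w => sub_nonneg.2 (hηx w)
  have hxm : x = planSum (η + m) := by
    rw [planSum_add, hm]
    abel
  have hmass : ∑ s, (η + m) s = 1 := by rw [← planSum_emptySeq, ← hxm, hx.1]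
  have hmass' : ∑ s, m s = ∑ s, (τ i s - η s) := by
    rw [Finset.sum_sub_distrib, (hmix i).2]
    simp only [Pi.add_apply, Finset.sum_add_distrib] at hmass
    linarith
  have : Nonempty (G.PureStrategy (some i)) := by
    by_contra hne
    rw [not_nonempty_iff] at hne
    have h1 := (hmix i).2
    rw [Finset.univ_eq_empty, Finset.sum_empty] at h1
    exact zero_ne_one h1
  obtain ⟨b, hb⟩ := Finite.exists_max fun s => payoffAgainst i s τ
  have h1 : ∑ s, m s * payoffAgainst i s τ ≤ ∑ s, (τ i s - η s) * payoffAgainst i s τ := by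
    calc ∑ s, m s * payoffAgainst i s τ ≤ ∑ s, m s * payoffAgainst i b τ :=
          Finset.sum_le_sum fun s _ => mul_le_mul_of_nonneg_left (hb s) (hm0 s)
      _ = ∑ s, (τ i s - η s) * payoffAgainst i b τ := by
          rw [← Finset.sum_mul, hmass', Finset.sum_mul]
      _ = ∑ s, (τ i s - η s) * payoffAgainst i s τ := by
          refine Finset.sum_congr rfl fun s _ => ?_
          rcases (hb s).lt_or_eq with hlt | heq
          · have : η s = τ i s := min_eq_right (hbest i s b hlt)
            rw [this, sub_self, zero_mul, zero_mul]
          · rw [heq]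
  change objective i (planOf τ) x ≤ objective i (planOf τ) (planSum (τ i))
  rw [hxm, objective_planSum hG, objective_planSum hG, hmass, (hmix i).2]
  simp only [Pi.add_apply, add_mul, sub_mul, Finset.sum_add_distrib, Finset.sum_sub_distrib]
    at h1 ⊢
  linarith

/-! ### From perturbed games to perfect equilibria -/

open Filter Topology in
/-- The correspondence from plans to mixed strategies is lower hemicontinuous: plans `γ k` that
converge to the plan of `σ` are realized by mixed strategies `τ k` converging to `σ`. If
`γ k` exceeds a perturbation `η k`, then `τ k` can be taken totally mixed, and to be the sum of a
nonnegative part realizing `γ k - η k` and a part of weights at most `ε k` realizing `η k`. The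
latter is claimed only when there are two different pure strategies: without information sets the
value of `η k` at `∅` is not restricted by `ε k`. -/
theorem exists_lift (hG : G.PerfectRecall) {i : N} {σ : G.PureStrategy (some i) → ℝ}
    (hσ : σ ∈ stdSimplex ℝ (G.PureStrategy (some i))) {ε : ℕ → ℝ} (hε : Tendsto ε atTop (𝓝 0))
    {η γ : ℕ → G.Seq (some i) → ℝ} (hη : ∀ k, IsRecursive (η k))
    (hηε : ∀ k I a, 0 < η k (ext I a) ∧ η k (ext I a) ≤ ε k)
    (hγ : ∀ k, γ k ∈ G.plans i) (hηγ : ∀ k w, η k w ≤ γ k w)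
    (hlim : Tendsto γ atTop (𝓝 (planSum σ))) :
    ∃ τ : ℕ → G.PureStrategy (some i) → ℝ,
      (∀ k, τ k ∈ stdSimplex ℝ (G.PureStrategy (some i))) ∧ (∀ k s, 0 < τ k s) ∧
      (∀ k, planSum (τ k) = γ k) ∧ Tendsto τ atTop (𝓝 σ) ∧
      ∀ k s s', s ≠ s' → ∃ m n, τ k = m + n ∧ (∀ s, 0 ≤ m s) ∧ planSum n = η k ∧
        n s ≤ ε k := by
  rcases isEmpty_or_nonempty (G.Info (some i)) with hI | hI
  · have hsub : ∀ s s' : G.PureStrategy (some i), s = s' := fun s s' =>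
      Subtype.ext (funext fun I => isEmptyElim I)
    refine ⟨fun _ => σ, fun _ => hσ, fun _ s => ?_, fun k => ?_, tendsto_const_nhds,
      fun k s s' h => absurd (hsub s s') h⟩
    · have h1 := hσ.2
      rw [Fintype.sum_eq_single s fun s' h => absurd (hsub s' s) h] at h1
      exact zero_lt_one.trans_eq h1.symm
    · funext w
      induction w using Seq.ext_induction hG with
      | empty => rw [planSum_emptySeq, hσ.2, (hγ k).1]
      | ext I a _ => exact (hI.false I).elim
  obtain ⟨I₀, hI₀⟩ := exists_seqTo_eq_nil hG (i := some i)
  have hηpos : ∀ k w, 0 < η k w := by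
    intro k w
    induction w using Seq.ext_induction hG with
    | empty =>
      rw [← hI₀, ← hη k I₀]
      exact Finset.sum_pos (fun a _ => (hηε k I₀ a).1) Finset.univ_nonempty
    | ext I a _ => exact (hηε k I a).1
  have hηext : ∀ I a, Tendsto (fun k => η k (ext I a)) atTop (𝓝 0) := fun I a =>
    squeeze_zero (fun k => (hηε k I a).1.le) (fun k => (hηε k I a).2) hε
  have hηlim : ∀ w, Tendsto (fun k => η k w) atTop (𝓝 0) := by
    intro w
    induction w using Seq.ext_induction hG with
    | empty =>
      rw [← hI₀]
      simp_rw [← hη _ I₀]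
      simpa [-Finset.univ_eq_attach] using
        tendsto_finsetSum Finset.univ fun a _ => hηext I₀ a
    | ext I a _ => exact hηext I a
  have hplim : ∀ w, Tendsto (fun k => γ k w - η k w) atTop (𝓝 (planSum σ w)) := fun w => by
    simpa using (tendsto_pi_nhds.1 hlim w).sub (hηlim w)
  -- `θ k → 1` is so small that `γ k - η k` still exceeds `θ k` times the plan of `σ`
  let r : G.Seq (some i) → ℕ → ℝ := fun w k =>
    if planSum σ w = 0 then 1 else min 1 ((γ k w - η k w) / planSum σ w)
  let θ : ℕ → ℝ := fun k => ∏ w, r w k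
  have hp0 : ∀ w, 0 ≤ planSum σ w := planSum_nonneg hσ.1
  have hr0 : ∀ w k, 0 ≤ r w k := by
    intro w k
    simp only [r]
    split_ifs
    · exact zero_le_one
    · exact le_min zero_le_one (div_nonneg (sub_nonneg.2 (hηγ k w)) (hp0 w))
  have hr1 : ∀ w k, r w k ≤ 1 := by
    intro w k
    simp only [r]
    split_ifs
    · exact le_rfl
    · exact min_le_left _ _
  have hrp : ∀ w k, r w k * planSum σ w ≤ γ k w - η k w := by
    intro w k
    simp only [r]
    split_ifs with h
    · rw [h, mul_zero]
      exact sub_nonneg.2 (hηγ k w)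
    · rw [← le_div_iff₀ (lt_of_le_of_ne (hp0 w) (Ne.symm h))]
      exact min_le_right _ _
  have hrlim : ∀ w, Tendsto (r w) atTop (𝓝 1) := by
    intro w
    simp only [r]
    split_ifs with h
    · exact tendsto_const_nhds
    · have := (tendsto_const_nhds (x := (1 : ℝ))).min ((hplim w).div_const (planSum σ w))
      rwa [div_self h, min_self] at this
  have hθ0 : ∀ k, 0 ≤ θ k := fun k => Finset.prod_nonneg fun w _ => hr0 w k
  have hθr : ∀ k w, θ k ≤ r w k := by
    intro k w
    simp only [θ]
    rw [← Finset.mul_prod_erase _ _ (Finset.mem_univ w)]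
    exact mul_le_of_le_one_right (hr0 w k)
      (Finset.prod_le_one (fun v _ => hr0 v k) fun v _ => hr1 v k)
  have hθlim : Tendsto θ atTop (𝓝 1) := by
    have := tendsto_finsetProd Finset.univ fun w _ => hrlim w
    rwa [Finset.prod_const_one] at this
  have hrest : ∀ k w, 0 ≤ (γ k - η k - θ k • planSum σ) w := by
    intro k w
    have := mul_le_mul_of_nonneg_right (hθr k w) (hp0 w)
    simp only [Pi.sub_apply, Pi.smul_apply, smul_eq_mul]
    linarith [hrp w k]
  choose m hm0 hm _ using fun k => exists_planSum_eq hG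
    ((IsRecursive.sub (hγ k).2.1 (hη k)).sub ((isRecursive_planSum σ).smul (θ k))) (hrest k)
  choose n hn0 hn hnpos using fun k => exists_planSum_eq hG (hη k) fun w => (hηpos k w).le
  have hplan : ∀ k, planSum (θ k • σ + m k + n k) = γ k := by
    intro k
    rw [planSum_add, planSum_add, planSum_smul, hm, hn]
    abel
  have hmass : ∀ k, ∑ s, (θ k • σ + m k + n k) s = 1 := by
    intro k
    rw [← planSum_emptySeq, hplan, (hγ k).1]
  have hpart : ∀ k s, 0 ≤ (θ k • σ + m k) s := fun k s =>
    add_nonneg (mul_nonneg (hθ0 k) (hσ.1 s)) (hm0 k s)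
  have hpos : ∀ k s, 0 < (θ k • σ + m k + n k) s := fun k s =>
    add_pos_of_nonneg_of_pos (hpart k s) (hnpos k (hηpos k) s)
  refine ⟨fun k => θ k • σ + m k + n k, fun k => ⟨fun s => (hpos k s).le, hmass k⟩, hpos, hplan,
    ?_, fun k s s' _ => ⟨θ k • σ + m k, n k, rfl, hpart k, hn k, ?_⟩⟩
  · -- the mass of the remaining parts is `1 - θ k`
    refine tendsto_pi_nhds.2 fun s => ?_
    have hupper : ∀ k, (θ k • σ + m k + n k) s ≤ θ k * σ s + (1 - θ k) := by
      intro k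
      have h1 := hmass k
      simp only [Pi.add_apply, Pi.smul_apply, smul_eq_mul, Finset.sum_add_distrib,
        ← Finset.mul_sum, hσ.2] at h1 ⊢
      have h2 := Finset.single_le_sum (f := m k) (fun s _ => hm0 k s) (Finset.mem_univ s)
      have h3 := Finset.single_le_sum (f := n k) (fun s _ => hn0 k s) (Finset.mem_univ s)
      linarith
    have hlower : ∀ k, θ k * σ s ≤ (θ k • σ + m k + n k) s := by
      intro k
      simp only [Pi.add_apply, Pi.smul_apply, smul_eq_mul]
      linarith [hm0 k s, hn0 k s]
    refine tendsto_of_tendsto_of_tendsto_of_le_of_le ?_ ?_ hlower hupper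
    · simpa using hθlim.mul_const (σ s)
    · simpa using (hθlim.mul_const (σ s)).add (hθlim.const_sub 1)
  · -- `s` takes some action `a` at the information set `I₀`, which follows the empty sequence
    have h0 : ∀ c ∈ (seqTo I₀).1, s.1 c.1 = some c.2 := by
      rw [hI₀]
      simp [emptySeq]
    obtain ⟨a, ha⟩ := Option.isSome_iff_exists.1 ((s.2 I₀).2 (Or.inr h0))
    have h1 : s.seqVal (ext I₀ a) = 1 := by
      rw [s.seqVal_ext, hI₀, s.seqVal_emptySeq]
      simp [PureStrategy.val, ha]
    calc n k s = s.seqVal (ext I₀ a) * n k s := by rw [h1, one_mul]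
      _ ≤ planSum (n k) (ext I₀ a) := Finset.single_le_sum
          (f := fun s => s.seqVal (ext I₀ a) * n k s)
          (fun s _ => mul_nonneg (s.seqVal_nonneg _) (hn0 k s)) (Finset.mem_univ s)
      _ ≤ ε k := by rw [hn]; exact (hηε k I₀ a).2

/-- In an equilibrium of the perturbed game no weight beyond the perturbation is put on a pure
strategy that is not a best response: it could be shifted to a better one. -/
theorem IsPerturbedNash.eq_zero [Fintype N] (hG : G.PerfectRecall) {η : G.SeqProfile}
    {τ : G.StrategyProfile} {ε : ℝ} (hε : IsPerturbation ε η)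
    (h : IsPerturbedNash η (planOf τ)) {i : N}
    {m n : G.PureStrategy (some i) → ℝ} (hτ : τ i = m + n) (hm : ∀ s, 0 ≤ m s)
    (hη : planSum n = η i) {s s' : G.PureStrategy (some i)}
    (hlt : payoffAgainst i s τ < payoffAgainst i s' τ) : m s = 0 := by
  by_contra hne
  have hpos : 0 < m s := lt_of_le_of_ne (hm s) (Ne.symm hne)
  have hplan : planOf τ i = planSum (m + n) := congrArg planSum hτ
  obtain ⟨⟨hmem, -⟩, hmax⟩ := h i
  have hmass : ∑ s, (m + n) s = 1 := by rw [← planSum_emptySeq, ← hplan, hmem.1]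
  let m' : G.PureStrategy (some i) → ℝ := m - m s • Pi.single s 1 + m s • Pi.single s' 1
  have hm' : ∀ t, 0 ≤ m' t := by
    intro t
    have h1 : 0 ≤ m s * (Pi.single s' 1 : G.PureStrategy (some i) → ℝ) t :=
      mul_nonneg hpos.le (by rw [Pi.single_apply]; split_ifs <;> simp)
    have h2 : 0 ≤ m t - m s * (Pi.single s 1 : G.PureStrategy (some i) → ℝ) t := by
      rw [Pi.single_apply]
      split_ifs with ht
      · simp [ht]
      · simpa using hm t
    exact add_nonneg h2 h1
  have hge : ∀ w, η i w ≤ planSum (m' + n) w := by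
    intro w
    rw [planSum_add, hη]
    exact le_add_of_nonneg_left (planSum_nonneg hm' w)
  have hmass' : ∑ t, (m' + n) t = 1 := by
    rw [← hmass]
    simp [m', Finset.sum_add_distrib, Finset.sum_sub_distrib, ← Finset.mul_sum]
  have h1 := hmax (show planSum (m' + n) ∈ perturbedPlans η i from
    ⟨⟨by rw [planSum_emptySeq, hmass'], isRecursive_planSum _,
      fun I a => (((hε i I).2 a).1.le).trans (hge _)⟩, hge⟩)
  change objective i (planOf τ) _ ≤ objective i (planOf τ) _ at h1
  rw [hplan, objective_planSum hG, objective_planSum hG, hmass, hmass'] at h1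
  have h2 : ∑ t, (m' + n) t * payoffAgainst i t τ = ∑ t, (m + n) t * payoffAgainst i t τ +
      m s * (payoffAgainst i s' τ - payoffAgainst i s τ) := by
    simp only [m', Pi.add_apply, Pi.sub_apply, Pi.smul_apply, smul_eq_mul, add_mul, sub_mul,
      Finset.sum_add_distrib, Finset.sum_sub_distrib, Pi.single_apply, mul_ite, mul_one, mul_zero,
      ite_mul, zero_mul, Finset.sum_ite_eq', Finset.mem_univ, if_true]
    ring
  have h3 := mul_pos hpos (sub_pos.2 hlt)
  linarith

end ExtensiveGame

end

theorem theorem1 {N A : Type*} [Fintype N] (G : ExtensiveGame N A) (hG : G.PerfectRecall)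
    (σ : G.StrategyProfile) (γ : G.SeqProfile) (hT : (σ, γ) ∈ G.T) :
    ExtensiveGame.IsNormalFormPerfect σ ↔
      ∃ (ε : ℕ → ℝ) (η : ℕ → G.SeqProfile) (γs : ℕ → G.SeqProfile),
        (∀ k, 0 < ε k) ∧ Filter.Tendsto ε Filter.atTop (nhds 0) ∧
        (∀ k, ExtensiveGame.IsPerturbation (ε k) (η k)) ∧
        (∀ k, ExtensiveGame.IsPerturbedNash (η k) (γs k)) ∧
        Filter.Tendsto γs Filter.atTop (nhds γ) := by
  obtain ⟨hσ, hγ⟩ := hT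
  simp only at hσ hγ
  subst hγ
  constructor
  · rintro ⟨-, ε, τ, hε, hε0, hτ, hcluster⟩
    obtain ⟨φ, hφ, hlim⟩ := hcluster.tendsto_subseq
    refine ⟨fun k => (1 + ∑ i, (Nat.card (G.PureStrategy (some i)) : ℝ)) * ε (φ k),
      fun k => ExtensiveGame.cutoff (ε (φ k)) (τ (φ k)),
      fun k => ExtensiveGame.planOf (τ (φ k)), fun k => ?_, ?_, fun k => ?_, fun k => ?_, ?_⟩
    · exact mul_pos (by positivity) (hε _)
    · simpa using (hε0.comp hφ.tendsto_atTop).const_mul _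
    · exact ExtensiveGame.isPerturbation_cutoff hG (hε (φ k)) (hτ (φ k)).2.1
    · exact (hτ (φ k)).isPerturbedNash hG
    · refine tendsto_pi_nhds.2 fun i => tendsto_pi_nhds.2 fun w => ?_
      exact tendsto_finsetSum _ fun s _ =>
        (tendsto_pi_nhds.1 (tendsto_pi_nhds.1 hlim i) s).const_mul _
  · rintro ⟨ε, η, γ, hε, hε0, hη, hγ, hlim⟩
    choose τ hτmix hτpos hτγ hτlim hτ using fun i => ExtensiveGame.exists_lift hG (hσ i) hε0
      (fun k I => (hη k i I).1) (fun k I => (hη k i I).2) (fun k => (hγ k i).1.1)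
      (fun k => (hγ k i).1.2) (tendsto_pi_nhds.1 hlim i)
    have hplan : ∀ k, ExtensiveGame.planOf (fun i => τ i k) = γ k := fun k =>
      funext fun i => hτγ i k
    refine ⟨hσ, ε, fun k i => τ i k, hε, hε0, fun k => ⟨fun i => hτmix i k, fun i => hτpos i k,
      fun i s s' hlt => ?_⟩, (tendsto_pi_nhds.2 hτlim).mapClusterPt⟩
    obtain ⟨m, n, hmn, hm, hn, hle⟩ := hτ i k s s' fun h => by simp [h] at hlt
    have h0 := ExtensiveGame.IsPerturbedNash.eq_zero hG (hη k) ((hplan k).symm ▸ hγ k) hmn hm hn hlt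
    change τ i k s ≤ ε k
    rw [hmn, Pi.add_apply, h0, zero_add]
    exact hle
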